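/- There is an absolute constant $c>0$ such that the following holds for all integers $d\ge 2$ and $1\le T\le d$. No noiseless hybrid quantum-classical algorithm of depth $T$ that makes at most $cd/T$ oracle queries can, given access to the search oracle $O_i$ for an arbitrary unknown $i\in[d]=\{1,\dots,d\}$, output $i$ with probability at least $2/3$; that is, for every such algorithm there is an $i\in[d]$ for which its output on $O_i$ equals $i$ with probability less than $2/3$. Here the oracle $O_i$ is available classically, as $x\mapsto \mathbf 1[x=i]$ for $x\in[d]$, and quantumly, as the unitary $|x\rangle|w\rangle\mapsto(-1)^{\mathbf 1[x=i]}|x\rangle|w\rangle$, where the elements of $[d]$ are encoded in binary on $\lceil\log_2 d\rceil$ address qubits (placed on any of the qubits of the circuit) and bit strings that encode no element of $[d]$ are left unchanged. A noiseless hybrid algorithm of depth $T$ is an adaptive randomized classical procedure which at each step, depending on everything seen so far, either draws classical randomness, or queries the oracle classically, or chooses a number $m$ of qubits and a circuit $U_{T'}\cdots U_1$ with $T'\le T$ layers and receives a string $s\in\{0,1\}^m$ with probability $|\langle s|U_{T'}\cdots U_1|0^m\rangle|^2$, or stops with an output in $[d]$. Each layer $U_k$ is either a tensor product of unitaries acting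 on disjoint sets of at most two qubits, or one application of the quantum oracle tensored with the identity. The number of queries is the maximum, over all root-to-leaf paths of the resulting decision tree, of the number of classical queries plus the number of oracle layers in the circuits run along the path. -/

import Mathlib

/-- Basis labels of `m` qubits, i.e. bit strings of length `m`. -/
abbrev BitString (m : ℕ) : Type := Fin m → Bool

/-- Unitaries on `m` qubits, as matrices in the computational basis. -/
abbrev QubitUnitary (m : ℕ) : Type := Matrix.unitaryGroup (BitString m) ℂ

/-- A depth-1 unitary: the qubits are partitioned into blocks of at most two qubits (the blocks are
the fibres of `b`), and `U` is the tensor product of one unitary per block. -/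
def IsDepthOne {m : ℕ} (U : QubitUnitary m) : Prop :=
  ∃ (b : Fin m → Fin m)
    (V : (k : Fin m) → Matrix.unitaryGroup ({q : Fin m // b q = k} → Bool) ℂ),
    (∀ k, Fintype.card {q : Fin m // b q = k} ≤ 2) ∧
    ∀ s t : BitString m,
      (U : Matrix (BitString m) (BitString m) ℂ) s t =
        ∏ k, (V k : Matrix ({q : Fin m // b q = k} → Bool) ({q : Fin m // b q = k} → Bool) ℂ)
          (fun q => s q) (fun q => t q)

/-- Number of qubits of the address register that holds an element of `{0, …, d - 1}` in binary. -/
abbrev addressLength (d : ℕ) : ℕ := Nat.clog 2 d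

/-- The classical search oracle `O_i : x ↦ 1[x = i]`. -/
def classicalOracle {d : ℕ} (i x : Fin d) : Bool := decide (x = i)

/-- The quantum search oracle `|x⟩|w⟩ ↦ (-1)^{1[x = i]} |x⟩|w⟩` on `m` qubits, where `x` is read in
binary from the qubits `addr 0, addr 1, …` (least significant bit first) and `w` stands for the
other qubits. -/
def phaseOracle {d m : ℕ} (i : Fin d) (addr : Fin (addressLength d) ↪ Fin m) : QubitUnitary m :=
  ⟨Matrix.diagonal fun s : BitString m =>
      if Nat.ofBits (fun j => s (addr j)) = (i : ℕ) then (-1 : ℂ) else 1, by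
    rw [Matrix.mem_unitaryGroup_iff, Matrix.star_eq_conjTranspose,
      Matrix.diagonal_conjTranspose, Matrix.diagonal_mul_diagonal, ← Matrix.diagonal_one]
    congr 1
    funext s
    simp only [Pi.star_apply]
    split_ifs <;> simp⟩

/-- One layer of a noiseless circuit on `m` qubits: a depth-1 unitary, or one oracle query whose
address register is placed on any qubits. -/
inductive Layer (d m : ℕ) : Type
  | gate (U : QubitUnitary m) (hU : IsDepthOne U) : Layer d m
  | query (addr : Fin (addressLength d) ↪ Fin m) : Layer d m

namespace Layer

/-- The unitary of a layer when the marked element is `i`. -/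
def unitary {d m : ℕ} (i : Fin d) : Layer d m → QubitUnitary m
  | gate U _ => U
  | query addr => phaseOracle i addr

/-- The number of oracle queries of a layer. -/
def queries {d m : ℕ} : Layer d m → ℕ
  | gate _ _ => 0
  | query _ => 1

end Layer

/-- The unitary `U_T ⋯ U_2 U_1` of the circuit with layers `[U_1, …, U_T]`, when the marked
element is `i`. -/
def circuitUnitary {d m : ℕ} (i : Fin d) : List (Layer d m) → QubitUnitary m
  | [] => 1
  | L :: C => circuitUnitary i C * L.unitary i

/-- The number of oracle queries of a circuit. -/
def circuitQueries {d m : ℕ} (C : List (Layer d m)) : ℕ := (C.map Layer.queries).sum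

theorem sum_column_norm_sq {m : ℕ} (U : QubitUnitary m) (t : BitString m) :
    ∑ s, ENNReal.ofReal
      (‖(U : Matrix (BitString m) (BitString m) ℂ) s t‖ ^ 2) = 1 := by
  rw [← ENNReal.ofReal_sum_of_nonneg (fun s _ => by positivity), ← ENNReal.ofReal_one]
  congr 1
  have h := Matrix.mem_unitaryGroup_iff'.1 U.2
  have h2 := congrFun (congrFun h t) t
  rw [Matrix.mul_apply, Matrix.one_apply_eq] at h2
  have h3 : ((∑ s, ‖(U : Matrix (BitString m) (BitString m) ℂ) s t‖ ^ 2 : ℝ) : ℂ) = 1 := by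
    rw [← h2]
    push_cast
    refine Finset.sum_congr rfl fun s _ => ?_
    rw [Matrix.star_apply]
    exact (Complex.conj_mul' _).symm
  exact_mod_cast h3

/-- The law of the string obtained by running the noiseless circuit `C` on `|0^m⟩` with marked
element `i` and measuring all qubits in the computational basis. -/
noncomputable def circuitOutput {d m : ℕ} (i : Fin d) (C : List (Layer d m)) :
    PMF (BitString m) :=
  PMF.ofFintype
    (fun s => ENNReal.ofReal
      (‖(circuitUnitary i C : Matrix (BitString m) (BitString m) ℂ) s (fun _ => false)‖ ^ 2))
    (sum_column_norm_sq _ _)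

/-- Noiseless hybrid quantum-classical algorithms of depth `T` for searching a marked element among
`d`, as adaptive decision trees: an algorithm stops with an output, draws classical randomness,
queries the oracle classically, or runs a circuit of at most `T` layers on any number of qubits
and measures it. It continues depending on what it has seen. -/
inductive HybridAlgorithm (d T : ℕ) : Type
  | output (x : Fin d) : HybridAlgorithm d T
  | random (p : PMF ℕ) (next : ℕ → HybridAlgorithm d T) : HybridAlgorithm d T
  | classicalQuery (x : Fin d) (next : Bool → HybridAlgorithm d T) : HybridAlgorithm d T
  | runCircuit (m : ℕ) (C : List (Layer d m)) (hC : C.length ≤ T)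
      (next : BitString m → HybridAlgorithm d T) : HybridAlgorithm d T

namespace HybridAlgorithm

/-- The law of the output of the algorithm when the marked element is `i`. -/
noncomputable def outputLaw {d T : ℕ} (i : Fin d) : HybridAlgorithm d T → PMF (Fin d)
  | output x => PMF.pure x
  | random p next => p.bind fun r => outputLaw i (next r)
  | classicalQuery x next => outputLaw i (next (classicalOracle i x))
  | runCircuit _ C _ next => (circuitOutput i C).bind fun s => outputLaw i (next s)

/-- The query complexity: the supremum over root-to-leaf paths of the total number of classical and
quantum oracle queries made along the path. -/
noncomputable def queryComplexity {d T : ℕ} : HybridAlgorithm d T → ℕ∞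
  | output _ => 0
  | random _ next => ⨆ r, queryComplexity (next r)
  | classicalQuery _ next => 1 + ⨆ a, queryComplexity (next a)
  | runCircuit _ C _ next => (circuitQueries C : ℕ∞) + ⨆ s, queryComplexity (next s)

end HybridAlgorithm

/-! Compare each marked oracle `O_i` with a blank oracle that marks nothing. At a node of the
decision tree let `a i` and `b` be the probabilities of arriving there under the two oracles, and
use `∑ i, halfHarmonic (a i) b` as potential. Each step lowers its expected total by a multiple of
`b` alone: at most `b` for a classical query, and at most `8 b q²` for a circuit with `q` queries,
by the hybrid argument summed over `i`. Since `q ≤ T`, the latter is at most `8 T b q`; the blank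
weights of the branches add up to `b`, so the whole tree loses at most `8 T N`
(`sum_halfHarmonic_le`). At the root the potential is `d / 2`. At the leaves success with
probability `2/3` makes the laws differ from the blank one, which does not depend on `i`, and the
potential falls short of `d / 2` by a multiple of `d`. Hence `T N` is of order at least `d`. -/

open scoped NNReal

/-! ### The potential and its loss under splitting -/

/-- Half the harmonic mean of two weights. -/
noncomputable def halfHarmonic (a b : ℝ≥0) : ℝ≥0 := a * b / (a + b)

theorem halfHarmonic_zero_left (b : ℝ≥0) : halfHarmonic 0 b = 0 := by simp [halfHarmonic]

theorem halfHarmonic_le_right (a b : ℝ≥0) : halfHarmonic a b ≤ b := by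
  unfold halfHarmonic
  refine div_le_of_le_mul₀ (by positivity) (by positivity) ?_
  rw [mul_comm b]
  gcongr
  exact le_self_add

/-- After multiplication by `a + b` the gap is `(l a - r b)²`; equality holds at `l = b / (a + b)`.
-/
theorem halfHarmonic_le_linear (a b l r : ℝ≥0) (h : l + r = 1) :
    halfHarmonic a b ≤ a * l ^ 2 + b * r ^ 2 := by
  unfold halfHarmonic
  refine div_le_of_le_mul₀ (by positivity) (by positivity) ?_
  rw [← NNReal.coe_le_coe]
  have hr : (r : ℝ) = 1 - l := by
    have : (l : ℝ) + r = 1 := by exact_mod_cast h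
    linarith
  push_cast
  rw [hr]
  nlinarith [sq_nonneg ((l : ℝ) * a - (1 - l) * b)]

/-- The defect of the tangent of `halfHarmonic` at `(a, b)`, evaluated at `(a x², b y²)`. -/
theorem tangent_le_halfHarmonic_add (a b x y : ℝ) (ha : 0 ≤ a) (hb : 0 ≤ b) :
    (b ^ 2 * (a * x ^ 2) + a ^ 2 * (b * y ^ 2)) / (a + b) ^ 2 ≤
      a * x ^ 2 * (b * y ^ 2) / (a * x ^ 2 + b * y ^ 2) + 2 * b * (x - y) ^ 2 := by
  have hu : 0 ≤ a * x ^ 2 := by positivity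
  have hv : 0 ≤ b * y ^ 2 := by positivity
  rcases (add_nonneg hu hv).eq_or_lt with h0 | h0
  · have hu0 : a * x ^ 2 = 0 := by linarith
    have hv0 : b * y ^ 2 = 0 := by linarith
    rw [hu0, hv0]
    simp only [mul_zero, add_zero, zero_div, zero_add]
    positivity
  rcases (add_nonneg ha hb).eq_or_lt with h1 | h1
  · have ha0 : a = 0 := by linarith
    have hb0 : b = 0 := by linarith
    simp [ha0, hb0]
  have key : (b ^ 2 * (a * x ^ 2) + a ^ 2 * (b * y ^ 2)) / (a + b) ^ 2 =
      a * x ^ 2 * (b * y ^ 2) / (a * x ^ 2 + b * y ^ 2) +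
        a ^ 2 * b ^ 2 * (x ^ 2 - y ^ 2) ^ 2 / ((a + b) ^ 2 * (a * x ^ 2 + b * y ^ 2)) := by
    have := h0.ne'
    have := h1.ne'
    field_simp
    ring
  rw [key]
  gcongr
  rw [div_le_iff₀ (by positivity)]
  -- The remainder in `key` contains `(x² - y²)² = (x - y)² (x + y)²`; this bounds the cofactor of
  -- `b (x - y)²`, so that the loss is linear in `b` and free of `a`.
  have h2 : a ^ 2 * b * (x + y) ^ 2 ≤ 2 * ((a + b) ^ 2 * (a * x ^ 2 + b * y ^ 2)) := by
    have e1 : a ^ 2 * b * (x + y) ^ 2 ≤ a ^ 2 * b * (2 * (x ^ 2 + y ^ 2)) := by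
      gcongr
      nlinarith [sq_nonneg (x - y)]
    have e2 : a * b ≤ (a + b) ^ 2 := by nlinarith [mul_nonneg ha hb]
    have e3 : a ^ 2 ≤ (a + b) ^ 2 := by nlinarith [mul_nonneg ha hb]
    have e4 := mul_le_mul_of_nonneg_right e2 hu
    have e5 := mul_le_mul_of_nonneg_right e3 hv
    nlinarith
  have h3 := mul_le_mul_of_nonneg_left h2 (mul_nonneg hb (sq_nonneg (x - y)))
  nlinarith

/-- Splitting the weights according to two distributions with amplitudes `x` and `y` lowers
`halfHarmonic` by at most twice the squared distance of the amplitudes. -/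
theorem halfHarmonic_le_sum_add {ι : Type*} [Fintype ι] (a b : ℝ≥0) (x y : ι → ℝ≥0)
    (hx : ∑ s, x s ^ 2 = 1) (hy : ∑ s, y s ^ 2 = 1) (δ : ι → ℝ≥0)
    (hδ : ∀ s, |(x s : ℝ) - y s| ≤ δ s) :
    halfHarmonic a b ≤
      ∑ s, halfHarmonic (a * x s ^ 2) (b * y s ^ 2) + 2 * b * ∑ s, δ s ^ 2 := by
  have hx' : ∑ s, (x s : ℝ) ^ 2 = 1 := by exact_mod_cast hx
  have hy' : ∑ s, (y s : ℝ) ^ 2 = 1 := by exact_mod_cast hy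
  rw [← NNReal.coe_le_coe]
  simp only [halfHarmonic]
  push_cast
  have h : ∀ s, ((b : ℝ) ^ 2 * (a * x s ^ 2) + a ^ 2 * (b * y s ^ 2)) / (a + b) ^ 2 ≤
      (a : ℝ) * x s ^ 2 * (b * y s ^ 2) / (a * x s ^ 2 + b * y s ^ 2) + 2 * b * (δ s) ^ 2 := by
    intro s
    refine (tangent_le_halfHarmonic_add a b (x s) (y s) a.2 b.2).trans ?_
    have : ((x s : ℝ) - y s) ^ 2 ≤ (δ s : ℝ) ^ 2 := by
      rw [← sq_abs]
      exact pow_le_pow_left₀ (abs_nonneg _) (hδ s) 2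
    gcongr
  have hs := Finset.sum_le_sum fun s (_ : s ∈ Finset.univ) => h s
  rw [Finset.sum_add_distrib, ← Finset.mul_sum] at hs
  refine le_trans (le_of_eq ?_) hs
  -- The tangent is linear and both distributions have mass 1, so the tangent terms sum to its value
  -- at `(a, b)`.
  rw [← Finset.sum_div, Finset.sum_add_distrib, ← Finset.mul_sum, ← Finset.mul_sum,
    ← Finset.mul_sum, ← Finset.mul_sum, hx', hy']
  rcases (add_nonneg a.2 b.2).eq_or_lt with h1 | h1
  · have h1' : (a : ℝ) + b = 0 := h1.symm
    rw [h1']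
    simp
  · have : (a : ℝ) + b ≠ 0 := h1.ne'
    field_simp
    ring

/-! ### Hybrid argument against the blank oracle -/

open Matrix

theorem norm_toLp_unitary_mulVec {m : ℕ} (U : QubitUnitary m) (v : BitString m → ℂ) :
    ‖WithLp.toLp 2 ((U : Matrix (BitString m) (BitString m) ℂ) *ᵥ v)‖ = ‖WithLp.toLp 2 v‖ := by
  have h : ∀ w : BitString m → ℂ, ((‖WithLp.toLp 2 w‖ ^ 2 : ℝ) : ℂ) = star w ⬝ᵥ w := by
    intro w
    rw [EuclideanSpace.norm_sq_eq, dotProduct]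
    push_cast
    exact Finset.sum_congr rfl fun s _ => (Complex.conj_mul' _).symm
  have h2 : ((‖WithLp.toLp 2 ((U : Matrix (BitString m) (BitString m) ℂ) *ᵥ v)‖ ^ 2 : ℝ) : ℂ) =
      ((‖WithLp.toLp 2 v‖ ^ 2 : ℝ) : ℂ) := by
    rw [h, h, star_mulVec, dotProduct_mulVec, vecMul_vecMul, ← star_eq_conjTranspose,
      mem_unitaryGroup_iff'.1 U.2, vecMul_one]
  exact (pow_left_inj₀ (norm_nonneg _) (norm_nonneg _) two_ne_zero).1 (by exact_mod_cast h2)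

/-- The unitary of a layer when no element is marked. -/
def Layer.blankUnitary {d m : ℕ} : Layer d m → QubitUnitary m
  | gate U _ => U
  | query _ => 1

/-- The unitary of a circuit when no element is marked. -/
def blankCircuitUnitary {d m : ℕ} : List (Layer d m) → QubitUnitary m
  | [] => 1
  | L :: C => blankCircuitUnitary C * L.blankUnitary

/-- The law of the measured string when no element is marked. -/
noncomputable def blankCircuitOutput {d m : ℕ} (C : List (Layer d m)) : PMF (BitString m) :=
  PMF.ofFintype
    (fun s => ENNReal.ofReal
      (‖(blankCircuitUnitary C : Matrix (BitString m) (BitString m) ℂ) s (fun _ => false)‖ ^ 2))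
    (sum_column_norm_sq _ _)

/-- A basis state encodes at most one element, so its amplitude is flipped for at most one `i`. -/
theorem sum_norm_sq_phaseOracle_sub_le {d m : ℕ} (addr : Fin (addressLength d) ↪ Fin m)
    (v : BitString m → ℂ) :
    ∑ i : Fin d, ‖WithLp.toLp 2
      ((phaseOracle i addr : Matrix (BitString m) (BitString m) ℂ) *ᵥ v - v)‖ ^ 2 ≤
      (2 * ‖WithLp.toLp 2 v‖) ^ 2 := by
  rw [mul_pow]
  simp only [EuclideanSpace.norm_sq_eq, phaseOracle, mulVec_diagonal, Pi.sub_apply]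
  rw [Finset.sum_comm, Finset.mul_sum]
  refine Finset.sum_le_sum fun s _ => ?_
  have h : ∀ i : Fin d, ‖(if Nat.ofBits (fun j => s (addr j)) = (i : ℕ) then (-1 : ℂ) else 1) * v s
      - v s‖ ^ 2 = if Nat.ofBits (fun j => s (addr j)) = (i : ℕ) then 2 ^ 2 * ‖v s‖ ^ 2 else 0 := by
    intro i
    split_ifs
    · rw [show (-1 : ℂ) * v s - v s = -2 * v s by ring, norm_mul, mul_pow]
      simp
    · simp
  simp only [h]
  by_cases hd : Nat.ofBits (fun j => s (addr j)) < d
  · rw [Finset.sum_eq_single_of_mem ⟨_, hd⟩ (Finset.mem_univ _)]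
    · simp
    · intro i _ hi
      rw [if_neg]
      intro h
      exact hi (Fin.ext h.symm)
  · rw [Finset.sum_eq_zero]
    · positivity
    · intro i _
      rw [if_neg]
      intro h
      exact hd (h ▸ i.2)

/-- Minkowski's inequality in `ℓ²`, which lets the deviations of successive queries add up. -/
theorem sum_add_sq_le {ι : Type*} [Fintype ι] (x y : ι → ℝ) (X Y : ℝ) (hX : 0 ≤ X) (hY : 0 ≤ Y)
    (hx : ∑ i, x i ^ 2 ≤ X ^ 2) (hy : ∑ i, y i ^ 2 ≤ Y ^ 2) :
    ∑ i, (x i + y i) ^ 2 ≤ (X + Y) ^ 2 := by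
  have h1 := Real.sum_mul_le_sqrt_mul_sqrt Finset.univ x y
  have h2 : √(∑ i, x i ^ 2) ≤ X := Real.sqrt_le_iff.2 ⟨hX, hx⟩
  have h3 : √(∑ i, y i ^ 2) ≤ Y := Real.sqrt_le_iff.2 ⟨hY, hy⟩
  have h4 := mul_le_mul h2 h3 (Real.sqrt_nonneg _) hX
  have h5 : ∑ i, (x i + y i) ^ 2 = ∑ i, x i ^ 2 + 2 * ∑ i, x i * y i + ∑ i, y i ^ 2 := by
    rw [Finset.mul_sum, ← Finset.sum_add_distrib, ← Finset.sum_add_distrib]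
    exact Finset.sum_congr rfl fun i _ => by ring
  nlinarith

/-- The hybrid argument, in squared form and summed over all marked elements. -/
theorem sum_norm_sq_circuit_sub_blank_le {d m : ℕ} (C : List (Layer d m)) :
    ∀ v : BitString m → ℂ, ∑ i : Fin d, ‖WithLp.toLp 2
      ((circuitUnitary i C : Matrix (BitString m) (BitString m) ℂ) *ᵥ v -
        (blankCircuitUnitary C : Matrix (BitString m) (BitString m) ℂ) *ᵥ v)‖ ^ 2 ≤
      (2 * circuitQueries C * ‖WithLp.toLp 2 v‖) ^ 2 := by
  induction C with
  | nil => intro v; simp [circuitUnitary, blankCircuitUnitary, circuitQueries]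
  | cons L C ih =>
    intro v
    cases L with
    | gate U hU =>
      simp only [circuitUnitary, blankCircuitUnitary, Layer.unitary, Layer.blankUnitary,
        Submonoid.coe_mul, ← mulVec_mulVec]
      refine (ih _).trans (le_of_eq ?_)
      rw [norm_toLp_unitary_mulVec]
      simp [circuitQueries, Layer.queries]
    | query addr =>
      simp only [circuitUnitary, blankCircuitUnitary, Layer.unitary, Layer.blankUnitary,
        Submonoid.coe_mul, ← mulVec_mulVec, Submonoid.coe_one, one_mulVec]
      have h1 := sum_add_sq_le _ _ _ _ (by positivity) (by positivity)
        (sum_norm_sq_phaseOracle_sub_le addr v) (ih v)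
      refine le_trans (Finset.sum_le_sum fun i _ => ?_) (h1.trans (le_of_eq ?_))
      · refine pow_le_pow_left₀ (norm_nonneg _) ?_ 2
        -- Telescoping: the error of this query is carried isometrically through the remaining
        -- marked circuit.
        rw [← norm_toLp_unitary_mulVec (circuitUnitary i C)
          ((phaseOracle i addr : Matrix (BitString m) (BitString m) ℂ) *ᵥ v - v), mulVec_sub]
        refine le_trans (le_of_eq ?_) (norm_add_le _ _)
        rw [← WithLp.toLp_add, sub_add_sub_cancel]
      · simp only [circuitQueries, Layer.queries, List.map_cons, List.sum_cons]
        push_cast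
        ring

theorem circuitQueries_le_length {d m : ℕ} (C : List (Layer d m)) :
    circuitQueries C ≤ C.length := by
  induction C with
  | nil => simp [circuitQueries]
  | cons L C ih =>
    have : L.queries ≤ 1 := by cases L <;> simp [Layer.queries]
    simp only [circuitQueries, List.map_cons, List.sum_cons, List.length_cons] at ih ⊢
    omega

theorem sum_column_nnnorm_sq {m : ℕ} (U : QubitUnitary m) (t : BitString m) :
    ∑ s, ‖(U : Matrix (BitString m) (BitString m) ℂ) s t‖₊ ^ 2 = 1 := by
  have h := sum_column_norm_sq U t
  rw [← ENNReal.coe_inj]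
  push_cast
  rw [← h]
  refine Finset.sum_congr rfl fun s _ => ?_
  rw [ENNReal.ofReal_pow (norm_nonneg _), ofReal_norm]
  rfl

theorem sum_halfHarmonic_le_of_circuit {d m : ℕ} (C : List (Layer d m)) (a : Fin d → ℝ≥0)
    (b : ℝ≥0) :
    ∑ i, halfHarmonic (a i) b ≤
      ∑ s : BitString m, ∑ i, halfHarmonic
        (a i * ‖(circuitUnitary i C : Matrix (BitString m) (BitString m) ℂ) s
          (fun _ => false)‖₊ ^ 2)
        (b * ‖(blankCircuitUnitary C : Matrix (BitString m) (BitString m) ℂ) s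
          (fun _ => false)‖₊ ^ 2) + 8 * b * circuitQueries C ^ 2 := by
  have h := Finset.sum_le_sum fun i (_ : i ∈ (Finset.univ : Finset (Fin d))) =>
    halfHarmonic_le_sum_add (a i) b _ _
      (sum_column_nnnorm_sq (circuitUnitary i C) (fun _ => false))
      (sum_column_nnnorm_sq (blankCircuitUnitary C) (fun _ => false))
      (fun s => ‖(circuitUnitary i C : Matrix (BitString m) (BitString m) ℂ) s (fun _ => false) -
        (blankCircuitUnitary C : Matrix (BitString m) (BitString m) ℂ) s (fun _ => false)‖₊)
      (fun s => abs_norm_sub_norm_le _ _)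
  refine h.trans ?_
  rw [Finset.sum_add_distrib, Finset.sum_comm, ← Finset.mul_sum]
  refine add_le_add_right ?_ _
  have h2 := sum_norm_sq_circuit_sub_blank_le C (Pi.single (fun _ => false) 1)
  simp only [mulVec_single_one, EuclideanSpace.norm_sq_eq] at h2
  rw [mul_pow, EuclideanSpace.norm_sq_eq] at h2
  have h3 : ∑ s : BitString m, ‖(Pi.single (fun _ => false) 1 : BitString m → ℂ) s‖ ^ 2 = 1 := by
    rw [Finset.sum_eq_single_of_mem (fun _ => false) (Finset.mem_univ _)]
    · simp
    · intro s _ hs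
      simp [hs]
  rw [h3] at h2
  rw [show 8 * b * (circuitQueries C : ℝ≥0) ^ 2 = 2 * b * ((2 * circuitQueries C) ^ 2 * 1) by ring]
  gcongr
  rw [← NNReal.coe_le_coe]
  push_cast
  exact h2

/-! ### Expectations and measurement laws -/

/-- The expectation of `w` under a law on a finite type. -/
noncomputable def PMF.expect {d : ℕ} (p : PMF (Fin d)) (w : Fin d → ℝ≥0) : ENNReal :=
  ∑ x, p x * w x

theorem PMF.expect_bind {α : Type*} {d : ℕ} (p : PMF α) (f : α → PMF (Fin d)) (w : Fin d → ℝ≥0) :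
    (p.bind f).expect w = ∑' r, p r * (f r).expect w := by
  simp only [PMF.expect, PMF.bind_apply, ← ENNReal.tsum_mul_right, Finset.mul_sum]
  rw [Summable.tsum_finsetSum fun _ _ => ENNReal.summable]
  simp only [mul_assoc]

theorem PMF.expect_pure {d : ℕ} (x : Fin d) (w : Fin d → ℝ≥0) :
    (PMF.pure x).expect w = w x := by
  rw [PMF.expect, Finset.sum_eq_single_of_mem x (Finset.mem_univ _)]
  · simp
  · intro y _ hy
    simp [PMF.pure_apply, hy]

theorem PMF.toReal_expect {d : ℕ} (p : PMF (Fin d)) (w : Fin d → ℝ≥0) :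
    (p.expect w).toReal = ∑ x, (p x).toReal * w x := by
  rw [PMF.expect, ENNReal.toReal_sum fun x _ => ENNReal.mul_ne_top (p.apply_ne_top x) (by simp)]
  simp

theorem PMF.expect_ne_top {d : ℕ} (p : PMF (Fin d)) (w : Fin d → ℝ≥0) : p.expect w ≠ ⊤ :=
  ENNReal.sum_ne_top.2 fun x _ => ENNReal.mul_ne_top (p.apply_ne_top x) (by simp)

theorem PMF.sum_toReal {d : ℕ} (p : PMF (Fin d)) : ∑ x, (p x).toReal = 1 := by
  have h := p.tsum_coe
  rw [tsum_fintype] at h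
  rw [← ENNReal.toReal_sum fun x _ => p.apply_ne_top x, h, ENNReal.toReal_one]

theorem circuitOutput_apply {d m : ℕ} (i : Fin d) (C : List (Layer d m)) (s : BitString m) :
    circuitOutput i C s = ((‖(circuitUnitary i C : Matrix (BitString m) (BitString m) ℂ) s
      (fun _ => false)‖₊ ^ 2 : ℝ≥0) : ENNReal) := by
  rw [circuitOutput, PMF.ofFintype_apply, ENNReal.ofReal_pow (norm_nonneg _), ofReal_norm]
  rfl

theorem blankCircuitOutput_apply {d m : ℕ} (C : List (Layer d m)) (s : BitString m) :
    blankCircuitOutput C s = ((‖(blankCircuitUnitary C : Matrix (BitString m) (BitString m) ℂ) s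
      (fun _ => false)‖₊ ^ 2 : ℝ≥0) : ENNReal) := by
  rw [blankCircuitOutput, PMF.ofFintype_apply, ENNReal.ofReal_pow (norm_nonneg _), ofReal_norm]
  rfl

/-! ### Induction over the decision tree -/

namespace HybridAlgorithm

/-- The law of the output of the algorithm when no element is marked. -/
noncomputable def blankLaw {d T : ℕ} : HybridAlgorithm d T → PMF (Fin d)
  | output x => PMF.pure x
  | random p next => p.bind fun r => blankLaw (next r)
  | classicalQuery _ next => blankLaw (next false)
  | runCircuit _ C _ next => (blankCircuitOutput C).bind fun s => blankLaw (next s)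

/-- Arbitrary weights `a`, `b` and budget `N` are needed because every branch rescales the weights
and spends queries. -/
theorem sum_halfHarmonic_le {d T : ℕ} (hT : 1 ≤ T) (w w' : Fin d → Fin d → ℝ≥0)
    (hw : ∀ i x a b, halfHarmonic a b ≤ a * w i x + b * w' i x) (A : HybridAlgorithm d T) :
    ∀ (N : ℕ), A.queryComplexity ≤ N → ∀ (a : Fin d → ℝ≥0) (b : ℝ≥0),
      ((∑ i, halfHarmonic (a i) b : ℝ≥0) : ENNReal) ≤
        ∑ i, (a i * (A.outputLaw i).expect (w i) + b * A.blankLaw.expect (w' i)) +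
          ((8 * T * N * b : ℝ≥0) : ENNReal) := by
  induction A with
  | output x =>
    intro N _ a b
    refine le_add_of_le_left ?_
    simp only [outputLaw, blankLaw, PMF.expect_pure]
    push_cast
    exact Finset.sum_le_sum fun i _ => by exact_mod_cast hw i x (a i) b
  | random p next ih =>
    intro N hN a b
    simp only [outputLaw, blankLaw, PMF.expect_bind]
    have h : ∀ r, (next r).queryComplexity ≤ N := fun r =>
      (le_iSup (fun r => (next r).queryComplexity) r).trans hN
    calc ((∑ i, halfHarmonic (a i) b : ℝ≥0) : ENNReal)
        = ∑' r, p r * ((∑ i, halfHarmonic (a i) b : ℝ≥0) : ENNReal) := by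
          rw [ENNReal.tsum_mul_right, p.tsum_coe, one_mul]
      _ ≤ ∑' r, p r * (∑ i, (a i * ((next r).outputLaw i).expect (w i) +
            b * (next r).blankLaw.expect (w' i)) + ((8 * T * N * b : ℝ≥0) : ENNReal)) :=
          ENNReal.tsum_le_tsum fun r => mul_le_mul_right (ih r N (h r) a b) _
      _ = _ := by
          simp only [mul_add, Finset.mul_sum]
          rw [ENNReal.tsum_add, ENNReal.tsum_mul_right, p.tsum_coe, one_mul,
            Summable.tsum_finsetSum fun _ _ => ENNReal.summable]
          congr 1
          refine Finset.sum_congr rfl fun i _ => ?_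
          rw [ENNReal.tsum_add, ← ENNReal.tsum_mul_left, ← ENNReal.tsum_mul_left]
          simp only [mul_left_comm]
  | classicalQuery x next ih =>
    intro N hN a b
    simp only [queryComplexity] at hN
    obtain ⟨N', rfl⟩ : ∃ N', N = 1 + N' := by
      refine Nat.exists_eq_add_of_le ?_
      exact_mod_cast le_self_add.trans hN
    have h : (next false).queryComplexity ≤ N' := by
      refine (le_iSup (fun r => (next r).queryComplexity) false).trans ?_
      push_cast at hN
      exact (ENat.add_le_add_iff_left ENat.one_ne_top).1 hN
    -- Only the marked element `x` can leave the `false` branch; dropping its weight costs at most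
    -- `b`.
    have h1 := ih false N' h (Function.update a x 0) b
    have h2 : ∑ i, halfHarmonic (a i) b ≤
        ∑ i, halfHarmonic (Function.update a x 0 i) b + b := by
      rw [← Finset.add_sum_erase _ _ (Finset.mem_univ x),
        ← Finset.add_sum_erase _ (fun i => halfHarmonic (Function.update a x 0 i) b)
          (Finset.mem_univ x), Function.update_self, halfHarmonic_zero_left, zero_add, add_comm]
      refine add_le_add (Finset.sum_le_sum fun i hi => ?_) (halfHarmonic_le_right _ _)
      rw [Function.update_of_ne (Finset.ne_of_mem_erase hi)]
    have h3 : 8 * T * N' * b + b ≤ 8 * T * ((1 + N' : ℕ) : ℝ≥0) * b := by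
      have : (1 : ℝ≥0) ≤ 8 * T := by
        have : (1 : ℝ≥0) ≤ T := by exact_mod_cast hT
        exact this.trans (le_mul_of_one_le_left (by positivity) (by norm_num))
      calc 8 * T * N' * b + b = 8 * T * N' * b + 1 * b := by rw [one_mul]
        _ ≤ 8 * T * N' * b + 8 * T * b := by gcongr
        _ = _ := by push_cast; ring
    calc ((∑ i, halfHarmonic (a i) b : ℝ≥0) : ENNReal)
        ≤ ((∑ i, halfHarmonic (Function.update a x 0 i) b : ℝ≥0) : ENNReal) + b := by
          exact_mod_cast h2
      _ ≤ _ := add_le_add_left h1 _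
      _ = ∑ i, ((Function.update a x 0 i : ℝ≥0) * ((next false).outputLaw i).expect (w i) +
            b * (next false).blankLaw.expect (w' i)) +
            ((8 * T * N' * b + b : ℝ≥0) : ENNReal) := by
          rw [add_assoc, ENNReal.coe_add]
      _ ≤ _ := by
          refine add_le_add (Finset.sum_le_sum fun i _ => ?_) (by exact_mod_cast h3)
          simp only [outputLaw, blankLaw]
          refine add_le_add_left ?_ _
          rcases eq_or_ne i x with rfl | hi
          · simp
          · rw [Function.update_of_ne hi, classicalOracle, decide_eq_false hi.symm]
  | runCircuit m C hC next ih =>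
    intro N hN a b
    simp only [queryComplexity] at hN
    obtain ⟨N', rfl⟩ : ∃ N', N = circuitQueries C + N' := by
      refine Nat.exists_eq_add_of_le ?_
      exact_mod_cast le_self_add.trans hN
    have h : ∀ s, (next s).queryComplexity ≤ N' := by
      intro s
      refine (le_iSup (fun r => (next r).queryComplexity) s).trans ?_
      push_cast at hN
      exact (ENat.add_le_add_iff_left (ENat.natCast_ne_top _)).1 hN
    simp only [outputLaw, blankLaw, PMF.expect_bind, tsum_fintype, circuitOutput_apply,
      blankCircuitOutput_apply]
    set p : Fin d → BitString m → ℝ≥0 := fun i s =>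
      ‖(circuitUnitary i C : Matrix (BitString m) (BitString m) ℂ) s (fun _ => false)‖₊ ^ 2
    set q : BitString m → ℝ≥0 := fun s =>
      ‖(blankCircuitUnitary C : Matrix (BitString m) (BitString m) ℂ) s (fun _ => false)‖₊ ^ 2
    have hq1 : ∑ s, q s = 1 := sum_column_nnnorm_sq _ _
    have h1 : ∑ i, halfHarmonic (a i) b ≤
        ∑ s, ∑ i, halfHarmonic (a i * p i s) (b * q s) + 8 * T * circuitQueries C * b := by
      refine (sum_halfHarmonic_le_of_circuit C a b).trans (add_le_add_right ?_ _)
      -- The depth enters here: it makes the quadratic loss linear in the number of queries.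
      have : (circuitQueries C : ℝ≥0) ≤ T := by
        exact_mod_cast (circuitQueries_le_length C).trans hC
      calc 8 * b * (circuitQueries C : ℝ≥0) ^ 2
          = 8 * b * ((circuitQueries C : ℝ≥0) * circuitQueries C) := by rw [sq]
        _ ≤ 8 * b * (T * circuitQueries C) := by gcongr
        _ = _ := by ring
    calc ((∑ i, halfHarmonic (a i) b : ℝ≥0) : ENNReal)
        ≤ ∑ s, ((∑ i, halfHarmonic (a i * p i s) (b * q s) : ℝ≥0) : ENNReal) +
            ((8 * T * circuitQueries C * b : ℝ≥0) : ENNReal) := by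
          rw [← ENNReal.ofNNReal_finsetSum]
          exact_mod_cast h1
      _ ≤ ∑ s, (∑ i, (((a i * p i s : ℝ≥0) : ENNReal) * ((next s).outputLaw i).expect (w i) +
            ((b * q s : ℝ≥0) : ENNReal) * (next s).blankLaw.expect (w' i)) +
              ((8 * T * N' * (b * q s) : ℝ≥0) : ENNReal)) +
            ((8 * T * circuitQueries C * b : ℝ≥0) : ENNReal) :=
          add_le_add_left (Finset.sum_le_sum fun s _ => ih s N' (h s) _ _) _
      _ = _ := by
          have e1 : ∑ s, 8 * T * N' * (b * q s) = 8 * T * N' * b := by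
            rw [← Finset.mul_sum, ← Finset.mul_sum, hq1, mul_one]
          rw [Finset.sum_add_distrib, ← ENNReal.ofNNReal_finsetSum, e1, Finset.sum_comm, add_assoc,
            ← ENNReal.coe_add]
          congr 1
          · refine Finset.sum_congr rfl fun i _ => ?_
            rw [Finset.sum_add_distrib, Finset.mul_sum, Finset.mul_sum]
            simp only [ENNReal.coe_mul, mul_assoc]
            rfl
          · congr 1
            push_cast
            ring

end HybridAlgorithm

/-! ### Numerical weights and conclusion -/

/-- The slopes are those of the tangents for `d = 2` with a uniform blank output: marked against
blank probability is `2/3 : 1/2` when `x = i` and `1/3 : 1/2` otherwise. -/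
theorem halfHarmonic_le_weights {d : ℕ} (i x : Fin d) (a b : ℝ≥0) :
    halfHarmonic a b ≤ a * (if x = i then 9 / 49 else 9 / 25) +
      b * (if x = i then 16 / 49 else 4 / 25) := by
  split_ifs
  · refine (halfHarmonic_le_linear a b (3 / 7) (4 / 7) ?_).trans (le_of_eq ?_)
    · rw [← NNReal.coe_inj]; norm_num
    · rw [div_pow, div_pow]; norm_num
  · refine (halfHarmonic_le_linear a b (3 / 5) (2 / 5) ?_).trans (le_of_eq ?_)
    · rw [← NNReal.coe_inj]; norm_num
    · rw [div_pow, div_pow]; norm_num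

theorem mainTheorem4 :
    ∃ c : ℝ, 0 < c ∧
      ∀ d T : ℕ, 2 ≤ d → 1 ≤ T → T ≤ d →
        ∀ (A : HybridAlgorithm d T) (N : ℕ),
          A.queryComplexity ≤ (N : ℕ∞) → (N : ℝ) ≤ c * (d : ℝ) / (T : ℝ) →
            ¬ ∀ i : Fin d, (2 / 3 : ENNReal) ≤ A.outputLaw i i := by
  -- Then `8 T N ≤ d / 250`, and `d / 2 ≤ d (6/49 + 3/25 + 4/25) + (16/49 - 4/25) + d / 250` fails
  -- for all `d ≥ 2`, only narrowly at `d = 2`.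
  refine ⟨1 / 2000, by norm_num, fun d T hd hT _ A N hN hNc hA => ?_⟩
  have hd' : (2 : ℝ) ≤ d := by exact_mod_cast hd
  have hT' : (0 : ℝ) < T := by exact_mod_cast hT
  have hTN : (T : ℝ) * N ≤ d / 2000 := by
    rw [le_div_iff₀ hT'] at hNc
    linarith
  have key := A.sum_halfHarmonic_le hT _ _ halfHarmonic_le_weights N hN (fun _ => 1) 1
  have hfin : ∀ i ∈ (Finset.univ : Finset (Fin d)),
      (((1 : ℝ≥0) : ENNReal) * (A.outputLaw i).expect (fun x => if x = i then 9 / 49 else 9 / 25) +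
        ((1 : ℝ≥0) : ENNReal) *
          A.blankLaw.expect (fun x => if x = i then 16 / 49 else 4 / 25)) ≠ ⊤ := by
    intro i _
    simp [PMF.expect_ne_top]
  have key' := ENNReal.toReal_mono
    (ENNReal.add_ne_top.2 ⟨ENNReal.sum_ne_top.2 hfin, ENNReal.coe_ne_top⟩) key
  rw [ENNReal.toReal_add (ENNReal.sum_ne_top.2 hfin) ENNReal.coe_ne_top,
    ENNReal.toReal_sum hfin] at key'
  simp only [ENNReal.coe_one, one_mul] at key'
  simp only [ENNReal.toReal_add (PMF.expect_ne_top _ _) (PMF.expect_ne_top _ _),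
    PMF.toReal_expect, ENNReal.coe_toReal, Finset.sum_add_distrib] at key'
  have hQ : ∑ i : Fin d, ∑ x, (A.blankLaw x).toReal *
      (((if x = i then 16 / 49 else 4 / 25 : ℝ≥0)) : ℝ) = 16 / 49 + (d - 1) * (4 / 25) := by
    -- The blank law is the same for all `i`, so each output `x` is the right answer for exactly one
    -- `i`.
    rw [Finset.sum_comm]
    have : ∀ x : Fin d, ∑ i, (A.blankLaw x).toReal *
        (((if x = i then 16 / 49 else 4 / 25 : ℝ≥0)) : ℝ) =
        (A.blankLaw x).toReal * (16 / 49 + (d - 1) * (4 / 25)) := by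
      intro x
      have e : ∀ i : Fin d, (((if x = i then 16 / 49 else 4 / 25 : ℝ≥0)) : ℝ) =
          4 / 25 + if x = i then 16 / 49 - 4 / 25 else 0 := by
        intro i
        split_ifs <;> norm_num
      simp only [e]
      rw [← Finset.mul_sum, Finset.sum_add_distrib]
      congr 1
      rw [Finset.sum_const, Finset.card_univ, Fintype.card_fin, nsmul_eq_mul, Finset.sum_ite_eq,
        if_pos (Finset.mem_univ _)]
      ring
    simp only [this]
    rw [← Finset.sum_mul, PMF.sum_toReal, one_mul]
  have hP : ∀ i : Fin d, ∑ x, (A.outputLaw i x).toReal *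
      (((if x = i then 9 / 49 else 9 / 25 : ℝ≥0)) : ℝ) ≤ 6 / 49 + 3 / 25 := by
    intro i
    have e : ∀ x : Fin d, (A.outputLaw i x).toReal *
        (((if x = i then 9 / 49 else 9 / 25 : ℝ≥0)) : ℝ) =
        (A.outputLaw i x).toReal * (9 / 25) -
          if x = i then (A.outputLaw i x).toReal * (9 / 25 - 9 / 49) else 0 := by
      intro x
      split_ifs <;> push_cast <;> ring
    have h23 : (2 / 3 : ℝ) ≤ (A.outputLaw i i).toReal := by
      have := ENNReal.toReal_mono ((A.outputLaw i).apply_ne_top i) (hA i)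
      simpa using this
    simp only [e]
    rw [Finset.sum_sub_distrib, ← Finset.sum_mul, PMF.sum_toReal, Finset.sum_ite_eq',
      if_pos (Finset.mem_univ _)]
    linarith
  have hP' := Finset.sum_le_sum fun i (_ : i ∈ (Finset.univ : Finset (Fin d))) => hP i
  have hL : ((∑ _i : Fin d, halfHarmonic 1 1 : ℝ≥0) : ℝ) = d / 2 := by
    simp [halfHarmonic]
    ring
  rw [hL, hQ] at key'
  simp only [Finset.sum_const, Finset.card_univ, Fintype.card_fin, nsmul_eq_mul] at hP'
  push_cast at key'
  linarith
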